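/- Let $k$ be a field, let $X$ be a smooth projective geometrically connected $k$-surface and let $f\colon X\to\mathbb{P}^1_k$ be a $k$-morphism whose generic fibre is a smooth (geometrically connected) curve of genus $0$ (a conic bundle). Assume that $f$ is relatively minimal: every birational morphism over $\mathbb{P}^1_k$ from $X$ to a smooth projective geometrically connected $k$-surface $Y\to\mathbb{P}^1_k$ is an isomorphism. A closed point of the base is said to be a point of bad reduction of a fibration if the fibre over it is not smooth over its residue field. Let $M\in\mathbb{P}^1_k$ be a closed point at which $f$ has bad reduction, let $K=k(M)$ be its residue field, let $f_K\colon X_K\to\mathbb{P}^1_K$ be the base change of $f$ from $k$ to $K$, and let $N$ be a $K$-rational point of $\mathbb{P}^1_K$ lying above $M$. Then $f_K$ has bad reduction at $N$. Moreover the bad fibre is the same one: the projections $\mathbb{P}^1_K\to\mathbb{P}^1_k$ and $X_K\to X$ induce an isomorphism of residue fields $k(M)\cong k(N)$ and, compatibly with it, an isomorphism of fibres $(X_K)_N\cong X_M$. -/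

import Mathlib

universe u

open CategoryTheory Limits AlgebraicGeometry

noncomputable section

attribute [local instance] MvPolynomial.gradedAlgebra

/-- Projective `n`-space over a commutative ring `k`: `Proj k[x₀, …, xₙ]`. -/
def ProjSpace (n : ℕ) (k : Type u) [CommRing k] : Scheme.{u} :=
  Proj (MvPolynomial.homogeneousSubmodule (Fin (n + 1)) k)

/-- The structure morphism `ℙⁿ_k ⟶ Spec k`. -/
def ProjSpace.toSpec (n : ℕ) (k : Type u) [CommRing k] :
    ProjSpace n k ⟶ Spec (CommRingCat.of k) :=
  Proj.toSpecZero (MvPolynomial.homogeneousSubmodule (Fin (n + 1)) k) ≫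
    Spec.map (CommRingCat.ofHom
      (algebraMap k (MvPolynomial.homogeneousSubmodule (Fin (n + 1)) k 0)))

/-- `s : X ⟶ Spec k` is projective: `X` is a closed `k`-subscheme of some `ℙⁿ_k`. -/
def IsProjectiveOver (k : Type u) [CommRing k] {X : Scheme.{u}}
    (s : X ⟶ Spec (CommRingCat.of k)) : Prop :=
  ∃ (n : ℕ) (i : X ⟶ ProjSpace n k), IsClosedImmersion i ∧ i ≫ ProjSpace.toSpec n k = s

/-- `s : X ⟶ Spec k` is a smooth projective geometrically connected `k`-surface. -/
structure IsSmoothProjectiveSurface (k : Type u) [Field k] {X : Scheme.{u}}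
    (s : X ⟶ Spec (CommRingCat.of k)) : Prop where
  projective : IsProjectiveOver k s
  smooth : SmoothOfRelativeDimension 2 s
  geometricallyConnected : GeometricallyConnected s

/-- The structure sheaf of a scheme, as a sheaf of abelian groups. -/
def structureSheafAb (C : Scheme.{u}) :
    Sheaf (Opens.grothendieckTopology C) AddCommGrpCat.{u} :=
  (sheafCompose _ (forget₂ CommRingCat.{u} RingCat.{u} ⋙ forget₂ RingCat.{u} AddCommGrpCat.{u})).obj
    C.sheaf

/-- `p : C ⟶ S` (with `S` the spectrum of a field) is a smooth proper geometrically connected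
curve of genus zero, i.e. with `H¹(C, 𝒪_C) = 0`. -/
structure IsSmoothGenusZeroCurve {C S : Scheme.{u}} (p : C ⟶ S) : Prop where
  proper : IsProper p
  smooth : SmoothOfRelativeDimension 1 p
  geometricallyConnected : GeometricallyConnected p
  genus_eq_zero : Subsingleton ((structureSheafAb C).H 1)

/-- A morphism is birational if it is an isomorphism over a dense open of the target whose
preimage is dense. -/
def IsBirationalMorphism {X Y : Scheme.{u}} (σ : X ⟶ Y) : Prop :=
  ∃ V : Y.Opens, Dense (V : Set Y) ∧ Dense ((σ ⁻¹ᵁ V : X.Opens) : Set X) ∧ IsIso (σ ∣_ V)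

/-- `f : X ⟶ ℙ¹_k` is a conic bundle: `X`, with its structure of `k`-scheme induced by `f`, is a
smooth projective geometrically connected surface and the generic fibre of `f` is a smooth curve
of genus zero. -/
structure IsConicBundle (k : Type u) [Field k] {X : Scheme.{u}} (f : X ⟶ ProjSpace 1 k) :
    Prop where
  surface : IsSmoothProjectiveSurface k (f ≫ ProjSpace.toSpec 1 k)
  genericFibre : ∃ η : ProjSpace 1 k, IsGenericPoint η Set.univ ∧
    IsSmoothGenusZeroCurve (f.fiberToSpecResidueField η)

/-- `f : X ⟶ ℙ¹_k` is relatively minimal: every birational morphism over `ℙ¹_k` from `X` to a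
smooth projective geometrically connected `k`-surface is an isomorphism. -/
def IsRelativelyMinimal (k : Type u) [Field k] {X : Scheme.{u}} (f : X ⟶ ProjSpace 1 k) : Prop :=
  ∀ (Y : Scheme.{u}) (g : Y ⟶ ProjSpace 1 k) (σ : X ⟶ Y),
    IsSmoothProjectiveSurface k (g ≫ ProjSpace.toSpec 1 k) → σ ≫ g = f →
    IsBirationalMorphism σ → IsIso σ

/-- `M` is a point of bad reduction of `f`: a closed point whose fibre is not smooth over the
residue field of `M`. -/
def HasBadReductionAt {X B : Scheme.{u}} (f : X ⟶ B) (M : B) : Prop :=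
  IsClosed {M} ∧ ¬ Smooth (f.fiberToSpecResidueField M)

/-- The base change `Z_T` of a morphism `s : Z ⟶ S` along `t : T ⟶ S`. -/
abbrev BaseChange {Z S T : Scheme.{u}} (s : Z ⟶ S) (t : T ⟶ S) : Scheme.{u} := pullback s t

/-- The base change `f_T : X_T ⟶ Z_T` of an `S`-morphism `f : X ⟶ Z` along `t : T ⟶ S`. -/
abbrev baseChangeHom {X Z S T : Scheme.{u}} (f : X ⟶ Z) (s : Z ⟶ S) (t : T ⟶ S) :
    BaseChange (f ≫ s) t ⟶ BaseChange s t :=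
  pullback.map (f ≫ s) t s t f (𝟙 T) (𝟙 S) (by simp) (by simp)

/-- The morphism `Spec k(M) ⟶ Spec k` of a point `M` of `ℙ¹_k`. -/
abbrev residueSpecToSpec (k : Type u) [Field k] (M : ProjSpace 1 k) :
    Spec ((ProjSpace 1 k).residueField M) ⟶ Spec (CommRingCat.of k) :=
  (ProjSpace 1 k).fromSpecResidueField M ≫ ProjSpace.toSpec 1 k

/-- A point `N` of an `S`-scheme `Z` (`S` the spectrum of a field `K`) is `K`-rational if its
residue field is `K`. -/
def IsRationalPoint {Z S : Scheme.{u}} (s : Z ⟶ S) (N : Z) : Prop :=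
  IsIso (Z.fromSpecResidueField N ≫ s)

end

/-! Smoothness of a fibre depends only on the fibre over its residue field, so it suffices to
identify the two fibres. The square formed by `f_K`, `f` and the projections is cartesian, so the
fibre at `N` is the fibre at `M` base changed along `k(M) → k(N)`. This extension is trivial:
rationality identifies `k(N)` with `K = k(M)`, turning it into a `k`-endomorphism of `K`, and `K` is
finite over `k` because `M` is closed. -/

/-- An endomorphism of the spectrum of a field `K` over a field `k` is an isomorphism if `K` is
of finite type over `k`. -/
lemma isIso_of_comp_eq_of_locallyOfFiniteType {k : Type u} [Field k] {K : CommRingCat.{u}}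
    (hK : IsField K) (p : Spec K ⟶ Spec (CommRingCat.of k)) [LocallyOfFiniteType p]
    (g : Spec K ⟶ Spec K) (hg : g ≫ p = p) : IsIso g := by
  let : Field K := hK.toField
  obtain ⟨φ, rfl⟩ := Spec.map_surjective p
  obtain ⟨γ, rfl⟩ := Spec.map_surjective g
  have hφ : φ.hom.FiniteType :=
    (HasRingHomProperty.Spec_iff (P := @LocallyOfFiniteType)).mp inferInstance
  rw [← Spec.map_comp] at hg
  have hγ : φ ≫ γ = φ := Spec.map_injective hg
  let : Algebra k K := φ.hom.toAlgebra
  have : Algebra.FiniteType k K := hφ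
  -- Zariski's lemma; a `k`-endomorphism of an algebraic extension is then bijective.
  have : Module.Finite k K := finite_of_finite_type_of_isJacobsonRing k K
  let γ' : K →ₐ[k] K :=
    { γ.hom with commutes' := fun r ↦ congr($(hγ).hom r) }
  have hbij : Function.Bijective γ.hom := Algebra.IsAlgebraic.algHom_bijective γ'
  have : IsIso γ := (ConcreteCategory.isIso_iff_bijective γ).mpr hbij
  infer_instance

/-- If the residue field of a point is that of the base, the point is closed. -/
lemma IsRationalPoint.isClosed_singleton {Z S : Scheme.{u}} {s : Z ⟶ S} [IsSeparated s] {N : Z}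
    (hN : IsRationalPoint s N) : IsClosed {N} := by
  have : IsIso (Z.fromSpecResidueField N ≫ s) := hN
  -- The composite with the separated `s` is an isomorphism, so the first factor is a closed
  -- immersion.
  exact isClosed_singleton_iff_isClosedImmersion.mpr
    (IsClosedImmersion.of_comp (Z.fromSpecResidueField N) s)

/-- A morphism induces a morphism on spectra of residue fields at a point and its image. -/
lemma exists_specResidueField_hom {W Z : Scheme.{u}} (q : W ⟶ Z) {N : W} {M : Z} (h : q N = M) :
    ∃ ε : Spec (W.residueField N) ⟶ Spec (Z.residueField M),
      ε ≫ Z.fromSpecResidueField M = W.fromSpecResidueField N ≫ q := by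
  subst h
  exact ⟨Spec.map (q.residueFieldMap N), by simp⟩

/-- Let `M` be a closed point of a scheme `Z` locally of finite type over a field `k`. Every
`k(M)`-rational point of `Z` base changed to `k(M)` that lies above `M` has the residue field
of `M`, by means of the projection. -/
lemma exists_specResidueField_iso_of_isRationalPoint {k : Type u} [Field k] {Z : Scheme.{u}}
    (s : Z ⟶ Spec (CommRingCat.of k)) [LocallyOfFiniteType s] {M : Z} (hM : IsClosed {M})
    (N : ↥(BaseChange s (Z.fromSpecResidueField M ≫ s)))
    (hN : IsRationalPoint (pullback.snd s (Z.fromSpecResidueField M ≫ s)) N)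
    (hNM : pullback.fst s (Z.fromSpecResidueField M ≫ s) N = M) :
    ∃ ε : Spec (Scheme.residueField _ N) ≅ Spec (Z.residueField M),
      ε.hom ≫ Z.fromSpecResidueField M =
        Scheme.fromSpecResidueField _ N ≫ pullback.fst s (Z.fromSpecResidueField M ≫ s) := by
  obtain ⟨ε, hε⟩ := exists_specResidueField_hom _ hNM
  have : IsClosedImmersion (Z.fromSpecResidueField M) :=
    isClosed_singleton_iff_isClosedImmersion.mp hM
  let r := Scheme.fromSpecResidueField _ N ≫ pullback.snd s (Z.fromSpecResidueField M ≫ s)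
  have : IsIso r := hN
  -- Only compatibility over `k` is available: `inv r ≫ ε` need not be the identity, since `N` may
  -- differ from the tautological point by a `k`-automorphism of `k(M)`.
  have hover : (inv r ≫ ε) ≫ Z.fromSpecResidueField M ≫ s = Z.fromSpecResidueField M ≫ s := by
    rw [Category.assoc, reassoc_of% hε, pullback.condition, IsIso.inv_comp_eq]
    simp [r]
  have : IsIso (inv r ≫ ε) := isIso_of_comp_eq_of_locallyOfFiniteType
    (Field.toIsField (Z.residueField M)) _ _ hover
  have : IsIso ε := IsIso.of_isIso_comp_left (inv r) ε
  exact ⟨asIso ε, hε⟩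

/-- The base change of an `S`-morphism `f` is also its base change along the projection. -/
lemma isPullback_baseChangeHom {X Z S T : Scheme.{u}} (f : X ⟶ Z) (s : Z ⟶ S) (t : T ⟶ S) :
    IsPullback (pullback.fst (f ≫ s) t) (baseChangeHom f s t) f (pullback.fst s t) := by
  refine IsPullback.of_bot (h₃₁ := t) (v₂₁ := pullback.snd s t) (v₂₂ := s) ?_
    (pullback.lift_fst _ _ _).symm (IsPullback.of_hasPullback _ _)
  rw [pullback.lift_snd, Category.comp_id]
  exact IsPullback.of_hasPullback _ _

/-- A morphism of fibres over an isomorphism of residue fields is an isomorphism, for a cartesian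
square. -/
lemma exists_fiber_iso_of_isPullback {X' X W Z : Scheme.{u}} {q' : X' ⟶ X} {f' : X' ⟶ W}
    {f : X ⟶ Z} {q : W ⟶ Z} (h : IsPullback q' f' f q) {N : W} {M : Z}
    (ε : Spec (W.residueField N) ≅ Spec (Z.residueField M))
    (hε : ε.hom ≫ Z.fromSpecResidueField M = W.fromSpecResidueField N ≫ q) :
    ∃ e : f'.fiber N ≅ f.fiber M, e.hom ≫ f.fiberι M = f'.fiberι N ≫ q' ∧
      e.hom ≫ f.fiberToSpecResidueField M = f'.fiberToSpecResidueField N ≫ ε.hom := by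
  have hN : IsPullback (f'.fiberι N) (f'.fiberToSpecResidueField N) f'
      (W.fromSpecResidueField N) := IsPullback.of_hasPullback _ _
  have hM : IsPullback (f.fiberι M) (f.fiberToSpecResidueField M) f
      (Z.fromSpecResidueField M) := IsPullback.of_hasPullback _ _
  have hN' : IsPullback (f'.fiberι N ≫ q') (f'.fiberToSpecResidueField N ≫ ε.hom) f
      (Z.fromSpecResidueField M) :=
    (hN.paste_horiz h).of_iso (Iso.refl _) (Iso.refl _) ε (Iso.refl _)
      (by simp) (by simp) (by simp) (by simp [hε])
  exact ⟨hN'.isoIsPullback _ _ hM, by simp, by simp⟩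

section ProjSpace

attribute [local instance] MvPolynomial.gradedAlgebra

/-- Homogeneous polynomials of degree zero are constants. -/
lemma algebraMap_homogeneousSubmodule_zero_surjective (σ : Type*) (R : Type u) [CommRing R] :
    Function.Surjective (algebraMap R (MvPolynomial.homogeneousSubmodule σ R 0)) := by
  rintro ⟨p, hp⟩
  rw [MvPolynomial.homogeneousSubmodule_zero, Submodule.mem_one] at hp
  obtain ⟨r, rfl⟩ := hp
  exact ⟨r, rfl⟩

instance (n : ℕ) (k : Type u) [CommRing k] : IsSeparated (ProjSpace.toSpec n k) := by
  have := Proj.isSeparated (MvPolynomial.homogeneousSubmodule (Fin (n + 1)) k)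
  exact MorphismProperty.comp_mem _ _ _ this inferInstance

instance (n : ℕ) (k : Type u) [CommRing k] : LocallyOfFiniteType (ProjSpace.toSpec n k) := by
  have : IsScalarTower k (MvPolynomial.homogeneousSubmodule (Fin (n + 1)) k 0)
      (MvPolynomial (Fin (n + 1)) k) :=
    ⟨fun a x y ↦ smul_mul_assoc a x.1 y⟩
  have : Algebra.FiniteType (MvPolynomial.homogeneousSubmodule (Fin (n + 1)) k 0)
      (MvPolynomial (Fin (n + 1)) k) :=
    -- Generators over `k` also generate over the degree-zero part.
    Algebra.FiniteType.of_restrictScalars_finiteType k _ _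
  have : LocallyOfFiniteType
      (Proj.toSpecZero (MvPolynomial.homogeneousSubmodule (Fin (n + 1)) k)) := inferInstance
  have : IsClosedImmersion (Spec.map (CommRingCat.ofHom
      (algebraMap k (MvPolynomial.homogeneousSubmodule (Fin (n + 1)) k 0)))) :=
    IsClosedImmersion.spec_of_surjective _
      (algebraMap_homogeneousSubmodule_zero_surjective (Fin (n + 1)) k)
  exact MorphismProperty.comp_mem _ _ _ ‹_› inferInstance

end ProjSpace

/-- With `K = k(M)`, `f_K : X_K ⟶ ℙ¹_K` the base change of `f`, and `N` a `K`-point of `ℙ¹_K`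
above `M`: the fibration `f_K` has bad reduction at `N`. The last part says that `k(N)/k(M)` is
trivial and that the fibre of `f_K` at `N` is carried isomorphically to that of `f` at `M` by the
projection, so that both fibres become reducible over the same extension. -/
theorem mainTheorem9 (k : Type u) [Field k] (X : Scheme.{u}) (f : X ⟶ ProjSpace 1 k)
    (hf : IsConicBundle k f) (hmin : IsRelativelyMinimal k f)
    (M : ProjSpace 1 k) (hM : HasBadReductionAt f M)
    (N : ↥(BaseChange (ProjSpace.toSpec 1 k) (residueSpecToSpec k M)))
    (hNrat : IsRationalPoint (pullback.snd (ProjSpace.toSpec 1 k) (residueSpecToSpec k M)) N)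
    (hNM : pullback.fst (ProjSpace.toSpec 1 k) (residueSpecToSpec k M) N = M) :
    HasBadReductionAt
      (baseChangeHom f (ProjSpace.toSpec 1 k) (residueSpecToSpec k M)) N ∧
    ∃ (e : (baseChangeHom f (ProjSpace.toSpec 1 k) (residueSpecToSpec k M)).fiber N ≅ f.fiber M)
      (ε : Spec (Scheme.residueField _ N) ≅ Spec (Scheme.residueField _ M)),
      e.hom ≫ f.fiberι M =
        (baseChangeHom f (ProjSpace.toSpec 1 k) (residueSpecToSpec k M)).fiberι N ≫
          pullback.fst (f ≫ ProjSpace.toSpec 1 k) (residueSpecToSpec k M) ∧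
      ε.hom ≫ (ProjSpace 1 k).fromSpecResidueField M =
        Scheme.fromSpecResidueField _ N ≫
          pullback.fst (ProjSpace.toSpec 1 k) (residueSpecToSpec k M) ∧
      e.hom ≫ f.fiberToSpecResidueField M =
        (baseChangeHom f (ProjSpace.toSpec 1 k) (residueSpecToSpec k M)).fiberToSpecResidueField N
          ≫ ε.hom := by
  obtain ⟨ε, hε⟩ :=
    exists_specResidueField_iso_of_isRationalPoint (ProjSpace.toSpec 1 k) hM.1 N hNrat hNM
  obtain ⟨e, he, he'⟩ := exists_fiber_iso_of_isPullback
    (isPullback_baseChangeHom f (ProjSpace.toSpec 1 k) (residueSpecToSpec k M)) ε hε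
  refine ⟨⟨hNrat.isClosed_singleton, fun hsmooth ↦ hM.2 ?_⟩, e, ε, he, hε, he'⟩
  -- Smoothness at `N` passes to `M` by composing with the isomorphisms `e.inv` and `ε.hom`.
  rw [← Iso.eq_inv_comp] at he'
  rw [he']
  infer_instance
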